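/- A graph $\Gamma$ consists of a set of vertices and a set of oriented edges, each with an origin and a terminus, together with an involution $e\mapsto e^{-1}$ on the oriented edges exchanging origin and terminus; loops and multiple edges are allowed, and a loop may or may not equal its own inverse. $\Gamma$ is $d$-regular if every vertex is the origin of exactly $d$ oriented edges. A path of length $n$ is a sequence of $n$ oriented edges in which each edge starts where the preceding one ends (for $n=0$, a single vertex); it is reduced if no edge $e$ in it is immediately followed by $e^{-1}$. Theorem 5.7. Let $d\ge 3$, let $\Gamma$ be a connected $d$-regular graph with infinitely many vertices, and let $x_0$ be any vertex of $\Gamma$. For $n\ge 0$ let $a_n$ be the number of reduced paths of length $n$ from $x_0$ to $x_0$, $b_n$ the number of all paths of length $n$ from $x_0$ to $x_0$, $r_n$ the number of reduced paths of length at most $n$ from $x_0$ to $x_0$, and $z_n$ the number of all paths of length at most $n$ from $x_0$ to $x_0$. Then (i) $\displaystyle\lim_{n\to\infty}\frac{a_n}{(d-1)^n}=\lim_{n\to\infty}\frac{b_n}{d^n}=0$; (ii) $\displaystyle\lim_{n\to\infty}\frac{r_n}{(d-1)^n}=\lim_{n\to\infty}\frac{z_n}{d^n}=0.$ -/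

import Mathlib

/-!
A graph, with loops and multiple edges allowed, is given by oriented edges and a formal reversal:
a vertex type `V` with `[Quiver V] [Quiver.HasInvolutiveReverse V]`. An arrow `e : x ⟶ y` is an
oriented edge from `x` to `y`, and `Quiver.reverse e : y ⟶ x` is the same edge traversed backwards.
A loop may or may not be equal to its own reverse; in the first case it contributes one to the
degree of its vertex, in the second case two. An edge-path is a `Quiver.Path`, its length is
`Quiver.Path.length`.
-/

namespace GraphPaths

universe u v

variable {V : Type u} [Quiver.{v} V]

/-- Every two vertices are joined by an edge-path. (As every edge can be traversed in both
directions, this is the connectedness of the underlying undirected graph.) -/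
def Connected (V : Type u) [Quiver.{v} V] : Prop :=
  ∀ x y : V, Nonempty (Quiver.Path x y)

/-- Every vertex is the origin of exactly `d` oriented edges. For `d ≠ 0` this includes that
the set of these edges is finite. -/
def RegularOfDegree (V : Type u) [Quiver.{v} V] (d : ℕ) : Prop :=
  ∀ x : V, Nat.card (Quiver.Star x) = d

/-- A path is reduced (has no backtracks) if no edge of it is directly followed by its reverse.
Successive edges `e : b ⟶ c` and `f : c ⟶ d` are compared as edges with origin `c`. -/
def IsReducedPath [Quiver.HasReverse V] {x : V} : ∀ {y : V}, Quiver.Path x y → Prop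
  | _, .nil => True
  | _, .cons .nil _ => True
  | _, .cons (.cons p e) f =>
      IsReducedPath (.cons p e) ∧ Quiver.Star.mk f ≠ Quiver.Star.mk (Quiver.reverse e)

/-- `a_n`: the number of reduced paths of length `n` from `x₀` to `x₀`. -/
noncomputable def numReducedClosed [Quiver.HasReverse V] (x₀ : V) (n : ℕ) : ℕ :=
  Nat.card {p : Quiver.Path x₀ x₀ // IsReducedPath p ∧ p.length = n}

/-- `b_n`: the number of all paths of length `n` from `x₀` to `x₀`. -/
noncomputable def numClosed (x₀ : V) (n : ℕ) : ℕ :=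
  Nat.card {p : Quiver.Path x₀ x₀ // p.length = n}

/-- `r_n`: the number of reduced paths of length at most `n` from `x₀` to `x₀`. -/
noncomputable def numReducedClosedLE [Quiver.HasReverse V] (x₀ : V) (n : ℕ) : ℕ :=
  Nat.card {p : Quiver.Path x₀ x₀ // IsReducedPath p ∧ p.length ≤ n}

/-- `z_n`: the number of all paths of length at most `n` from `x₀` to `x₀`. -/
noncomputable def numClosedLE (x₀ : V) (n : ℕ) : ℕ :=
  Nat.card {p : Quiver.Path x₀ x₀ // p.length ≤ n}

end GraphPaths

open Filter Topology

namespace GraphPaths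

/-! ### Averaging over the predecessors of a relation with constant in- and out-degree. -/

section DoublyRegular

variable {E : Type*} {R : E → E → Prop} {k : ℕ}

/-! Let the walk live on oriented edges, with `R e f` when `f` may follow `e`. Every edge has `k`
successors and, by reversal, `k` predecessors: `k = d` for all paths, `k = d - 1` for reduced ones.
Up to the factor `k ^ n`, path counts are bounded by the `n`-th iterate of `predAvg` on the
indicator of the edges leaving `x₀`.

Averaging preserves the total mass of a nonnegative summable function and does not increase its ℓ²
norm; the loss in ℓ² is a sum of variances. These losses tend to zero, so the value at `e` at time
`n` and that at `f` at time `n + 1` merge whenever `R e f`. By connectedness, the value at a fixed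
edge is asymptotically shared by infinitely many edges at one common time lag (0 or 1). Finite total
mass forces it to zero (`tendsto_iterate_predAvg`). Part (ii) follows from (i) because `k ≥ 2`. -/

/-- The average of `g` over the `R`-predecessors of `f`, when these are `k` in number. -/
noncomputable def predAvg (R : E → E → Prop) (k : ℕ) (g : E → ℝ) (f : E) : ℝ :=
  (∑' e : {e // R e f}, g e) / k

/-- The pairs related by `R`, fibred over the second or over the first component. -/
def sigmaPredEquivSigmaSucc (R : E → E → Prop) :
    (Σ f, {e // R e f}) ≃ Σ e, {f // R e f} where
  toFun x := ⟨x.2.1, x.1, x.2.2⟩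
  invFun x := ⟨x.2.1, x.1, x.2.2⟩
  left_inv _ := rfl
  right_inv _ := rfl

theorem predAvg_nonneg {g : E → ℝ} (hg : ∀ e, 0 ≤ g e) (f : E) : 0 ≤ predAvg R k g f :=
  div_nonneg (tsum_nonneg fun _ => hg _) (Nat.cast_nonneg _)

theorem iterate_predAvg_nonneg {g : E → ℝ} (hg : ∀ e, 0 ≤ g e) (n : ℕ) (e : E) :
    0 ≤ (predAvg R k)^[n] g e := by
  induction n generalizing e with
  | zero => exact hg e
  | succ n ih =>
    rw [Function.iterate_succ_apply']
    exact predAvg_nonneg ih e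

/-- Double counting of the pairs in `R`: each `g e` occurs once for each of the `k` successors of
`e`. -/
theorem hasSum_tsum_pred (hk : 0 < k) (hs : ∀ e, Nat.card {f // R e f} = k)
    {g : E → ℝ} (hg : ∀ e, 0 ≤ g e) (hsum : Summable g) :
    HasSum (fun f => ∑' e : {e // R e f}, g e) (k * ∑' e, g e) := by
  have hfib : ∀ e, ∑' _ : {f // R e f}, g e = k * g e := fun e => by
    rw [tsum_const, hs, nsmul_eq_mul]
  have hsucc : Summable fun x : Σ e, {f // R e f} => g x.1 := by
    rw [summable_sigma_of_nonneg fun x => hg x.1]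
    refine ⟨fun e => ?_, ?_⟩
    · have : Finite {f // R e f} := Nat.finite_of_card_ne_zero (by rw [hs]; exact hk.ne')
      exact Summable.of_finite
    · simpa only [hfib] using hsum.mul_left (k : ℝ)
  have hpred : Summable fun x : Σ f, {e // R e f} => g x.2 :=
    (sigmaPredEquivSigmaSucc R).summable_iff.2 hsucc
  have htsum : ∑' x : Σ f, {e // R e f}, g x.2 = k * ∑' e, g e := by
    rw [← tsum_mul_left, ← tsum_congr hfib, ← hsucc.tsum_sigma]
    exact (sigmaPredEquivSigmaSucc R).tsum_eq fun x : Σ e, {f // R e f} => g x.1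
  rw [← htsum, hpred.tsum_sigma]
  exact hpred.sigma.hasSum

theorem hasSum_predAvg (hk : 0 < k) (hs : ∀ e, Nat.card {f // R e f} = k)
    {g : E → ℝ} (hg : ∀ e, 0 ≤ g e) (hsum : Summable g) :
    HasSum (predAvg R k g) (∑' e, g e) := by
  have h := (hasSum_tsum_pred hk hs hg hsum).div_const (k : ℝ)
  rwa [mul_div_cancel_left₀ _ (Nat.cast_ne_zero.2 hk.ne')] at h

theorem iterate_predAvg_hasSum (hk : 0 < k) (hs : ∀ e, Nat.card {f // R e f} = k)
    {g : E → ℝ} (hg : ∀ e, 0 ≤ g e) (hsum : Summable g) (n : ℕ) :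
    HasSum ((predAvg R k)^[n] g) (∑' e, g e) := by
  induction n with
  | zero => exact hsum.hasSum
  | succ n ih =>
    rw [Function.iterate_succ_apply', ← ih.tsum_eq]
    exact hasSum_predAvg hk hs (iterate_predAvg_nonneg hg n) ih.summable

theorem summable_sq_of_nonneg {g : E → ℝ} (hg : ∀ e, 0 ≤ g e) (hsum : Summable g) :
    Summable fun e => g e ^ 2 := by
  refine Summable.of_nonneg_of_le (fun _ => sq_nonneg _) (fun e => ?_)
    (hsum.mul_left (∑' e, g e))
  rw [sq]
  exact mul_le_mul_of_nonneg_right (hsum.le_tsum e fun _ _ => hg _) (hg e)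

/-- The drop of the `ℓ²` norm under averaging controls the oscillation along `R`. -/
theorem sq_sub_predAvg_le (hk : 0 < k) (hs : ∀ e, Nat.card {f // R e f} = k)
    (hp : ∀ f, Nat.card {e // R e f} = k)
    {g : E → ℝ} (hg : ∀ e, 0 ≤ g e) (hsum : Summable g) {e f : E} (hef : R e f) :
    (g e - predAvg R k g f) ^ 2 ≤ k * (∑' e, g e ^ 2 - ∑' f, predAvg R k g f ^ 2) := by
  have hk' : (k : ℝ) ≠ 0 := Nat.cast_ne_zero.2 hk.ne'
  -- Variance identity; summed over `f`, its right side gives `k` times the drop in the squared ℓ²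
  -- norm.
  have hvar : ∀ f, ∑' e : {e // R e f}, (g e - predAvg R k g f) ^ 2 =
      (∑' e : {e // R e f}, g e ^ 2) - k * predAvg R k g f ^ 2 := fun f => by
    have hfin : Finite {e // R e f} := Nat.finite_of_card_ne_zero (by rw [hp]; exact hk.ne')
    have := Fintype.ofFinite {e // R e f}
    have hm : ∑ e : {e // R e f}, g e = k * predAvg R k g f := by
      rw [predAvg, tsum_fintype, mul_div_cancel₀ _ hk']
    have hc : (Finset.univ : Finset {e // R e f}).card = k := by
      rw [Finset.card_univ, ← Nat.card_eq_fintype_card, hp]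
    simp only [tsum_fintype, sub_sq, Finset.sum_add_distrib, Finset.sum_sub_distrib,
      ← Finset.sum_mul, ← Finset.mul_sum, hm, Finset.sum_const, hc, nsmul_eq_mul]
    ring
  have hD := (hasSum_tsum_pred hk hs (fun e => sq_nonneg (g e)) (summable_sq_of_nonneg hg hsum)).sub
    ((summable_sq_of_nonneg (predAvg_nonneg hg)
      (hasSum_predAvg hk hs hg hsum).summable).hasSum.mul_left (k : ℝ))
  simp only [← hvar, ← mul_sub] at hD
  have hfin : Finite {e // R e f} := Nat.finite_of_card_ne_zero (by rw [hp]; exact hk.ne')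
  calc (g e - predAvg R k g f) ^ 2
      ≤ ∑' e : {e // R e f}, (g e - predAvg R k g f) ^ 2 :=
        (Summable.of_finite (f := fun e : {e // R e f} => (g e - predAvg R k g f) ^ 2)).le_tsum
          ⟨e, hef⟩ fun _ _ => sq_nonneg _
    _ ≤ _ := le_hasSum hD f fun _ _ => tsum_nonneg fun _ => sq_nonneg _

/-- The squared ℓ² norms `Q n` decrease and are bounded below, so their successive drops vanish in
the limit. -/
theorem tendsto_iterate_predAvg_sub (hk : 0 < k) (hs : ∀ e, Nat.card {f // R e f} = k)
    (hp : ∀ f, Nat.card {e // R e f} = k)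
    {g : E → ℝ} (hg : ∀ e, 0 ≤ g e) (hsum : Summable g) {e f : E} (hef : R e f) :
    Tendsto (fun n => (predAvg R k)^[n] g e - (predAvg R k)^[n + 1] g f) atTop (𝓝 0) := by
  set Q : ℕ → ℝ := fun n => ∑' e, (predAvg R k)^[n] g e ^ 2 with hQ
  have hstep : ∀ n {e f : E}, R e f →
      ((predAvg R k)^[n] g e - (predAvg R k)^[n + 1] g f) ^ 2 ≤ k * (Q n - Q (n + 1)) :=
    fun n e f hef => by
      simp only [hQ, Function.iterate_succ_apply']
      exact sq_sub_predAvg_le hk hs hp (iterate_predAvg_nonneg hg n)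
        (iterate_predAvg_hasSum hk hs hg hsum n).summable hef
  have hanti : Antitone Q := antitone_nat_of_succ_le fun n => by
    have h := (sq_nonneg _).trans (hstep n hef)
    exact sub_nonneg.1 (nonneg_of_mul_nonneg_right h (Nat.cast_pos.2 hk))
  have hlim := tendsto_atTop_ciInf hanti
    ⟨0, by rintro _ ⟨n, rfl⟩; exact tsum_nonneg fun _ => sq_nonneg _⟩
  have hdiff : Tendsto (fun n => k * (Q n - Q (n + 1))) atTop (𝓝 0) := by
    simpa using (hlim.sub (hlim.comp (tendsto_add_atTop_nat 1))).const_mul (k : ℝ)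
  have hsq := squeeze_zero (fun n => sq_nonneg _) (fun n => hstep n hef) hdiff
  rw [tendsto_zero_iff_abs_tendsto_zero]
  simpa [Function.comp_def, Real.sqrt_sq_eq_abs] using (Real.continuous_sqrt.tendsto 0).comp hsq

end DoublyRegular

/-- If `M` points all carry nearly the value `a n`, then `M * a n` is at most about the total mass
`C`, and `M` is arbitrary. -/
theorem tendsto_zero_of_infinite_sub_tendsto_zero {E : Type*} {u : ℕ → E → ℝ} {C : ℝ} {j : ℕ}
    (hu : ∀ n e, 0 ≤ u n e) (hC : ∀ n, HasSum (u n) C) {a : ℕ → ℝ} (ha : ∀ n, 0 ≤ a n)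
    (hinf : {e | Tendsto (fun n => a n - u (n + j) e) atTop (𝓝 0)}.Infinite) :
    Tendsto a atTop (𝓝 0) := by
  rw [Metric.tendsto_nhds]
  intro ε hε
  obtain ⟨M, hM⟩ := exists_nat_gt (2 * C / ε)
  have hM' : 2 * C < ε * M := by rwa [div_lt_iff₀' hε] at hM
  obtain ⟨t, ht, hcard⟩ := hinf.exists_subset_card_eq M
  have hsum : Tendsto (fun n => ∑ e ∈ t, (a n - u (n + j) e)) atTop (𝓝 0) := by
    simpa using tendsto_finsetSum t fun e he => ht he
  have hC0 : 0 ≤ C := (hC 0).nonneg (hu 0)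
  have hM0 : (0 : ℝ) < M := by
    by_contra h
    nlinarith
  filter_upwards [hsum.eventually_lt_const (u := ε * M - C) (by linarith)] with n hn
  have hle : ∑ e ∈ t, u (n + j) e ≤ C := sum_le_hasSum t (fun e _ => hu _ e) (hC (n + j))
  rw [Finset.sum_sub_distrib, Finset.sum_const, hcard, nsmul_eq_mul] at hn
  rw [Real.dist_0_eq_abs, abs_of_nonneg (ha n)]
  nlinarith

theorem tendsto_zero_of_le_half_add {s a : ℕ → ℝ} (hs : ∀ n, 0 ≤ s n)
    (hrec : ∀ n, s (n + 1) ≤ s n / 2 + a (n + 1)) (ha : Tendsto a atTop (𝓝 0)) :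
    Tendsto s atTop (𝓝 0) := by
  rw [Metric.tendsto_nhds]
  intro ε hε
  obtain ⟨N, hN⟩ := eventually_atTop.1 (ha.eventually_lt_const (u := ε / 4) (by linarith))
  -- `ε / 2` is the fixed point of `s ↦ s / 2 + ε / 4`.
  have hbound : ∀ m, s (N + m) ≤ s N * (1 / 2) ^ m + ε / 2 := fun m => by
    induction m with
    | zero => simp; linarith
    | succ m ih =>
      have := hrec (N + m)
      have := hN (N + m + 1) (by omega)
      rw [pow_succ, ← add_assoc]
      linarith
  have hlim : Tendsto (fun m : ℕ => s N * (1 / 2 : ℝ) ^ m) atTop (𝓝 0) := by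
    simpa using (tendsto_pow_atTop_nhds_zero_of_lt_one (r := (1 / 2 : ℝ)) (by norm_num)
      (by norm_num)).const_mul (s N)
  obtain ⟨m₀, hm₀⟩ := eventually_atTop.1 (hlim.eventually_lt_const (u := ε / 2) (by linarith))
  filter_upwards [eventually_ge_atTop (N + m₀)] with n hn
  obtain ⟨m, rfl⟩ := Nat.exists_eq_add_of_le (show N ≤ n by omega)
  rw [Real.dist_0_eq_abs, abs_of_nonneg (hs _)]
  linarith [hbound m, hm₀ m (by omega)]

end GraphPaths

namespace GraphPaths

universe u v

variable {V : Type u} [Quiver.{v} V]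

/-- The oriented edges with a given origin. -/
def starEquivOriginFiber (x : V) : Quiver.Star x ≃ {e : Quiver.Total V // e.left = x} where
  toFun e := ⟨⟨x, e.1, e.2⟩, rfl⟩
  invFun e := ⟨e.1.right, e.1.hom.cast e.2 rfl⟩
  left_inv _ := rfl
  right_inv := by
    rintro ⟨⟨a, b, e⟩, rfl⟩
    rfl

theorem ncard_origin_eq {d : ℕ} (hreg : RegularOfDegree V d) (x : V) :
    {e : Quiver.Total V | e.left = x}.ncard = d := by
  rw [← Nat.card_coe_set_eq, ← hreg x]
  exact (Nat.card_congr (starEquivOriginFiber x)).symm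

/-! ### Decay of the edge walk on an infinite connected graph. -/

section Reverse

variable [Quiver.HasInvolutiveReverse V]

/-- The reversal of oriented edges. -/
def totalReverse : Equiv.Perm (Quiver.Total V) where
  toFun e := ⟨e.right, e.left, Quiver.reverse e.hom⟩
  invFun e := ⟨e.right, e.left, Quiver.reverse e.hom⟩
  left_inv e := by simp
  right_inv e := by simp

@[simp] theorem totalReverse_left (e : Quiver.Total V) : (totalReverse e).left = e.right := rfl

@[simp] theorem totalReverse_right (e : Quiver.Total V) : (totalReverse e).right = e.left := rfl

@[simp] theorem totalReverse_totalReverse (e : Quiver.Total V) :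
    totalReverse (totalReverse e) = e := totalReverse.left_inv e

variable {R : Quiver.Total V → Quiver.Total V → Prop} {k : ℕ}

theorem card_pred_of_card_succ (hrev : ∀ e f, R e f ↔ R (totalReverse f) (totalReverse e))
    (hs : ∀ e, Nat.card {f // R e f} = k) (f : Quiver.Total V) :
    Nat.card {e // R e f} = k := by
  rw [← hs (totalReverse f)]
  exact Nat.card_congr (totalReverse.subtypeEquiv fun e => hrev e f)

/-- Let `R` be a rule saying which edge may follow which, invariant under reversal, with `k`
continuations of every edge, and such that two edges with the same terminus have a common
continuation. On an infinite connected graph the walk driven by `R` has no mass in the limit. -/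
theorem tendsto_iterate_predAvg [Infinite V] (hconn : Connected V) (hk : 0 < k)
    (hadj : ∀ e f, R e f → e.right = f.left)
    (hrev : ∀ e f, R e f ↔ R (totalReverse f) (totalReverse e))
    (hs : ∀ e, Nat.card {f // R e f} = k)
    (hcommon : ∀ e e' : Quiver.Total V, e.right = e'.right → ∃ f, R e f ∧ R e' f)
    {g : Quiver.Total V → ℝ} (hg : ∀ e, 0 ≤ g e) (hsum : Summable g) (e₀ : Quiver.Total V) :
    Tendsto (fun n => (predAvg R k)^[n] g e₀) atTop (𝓝 0) := by
  have hp := card_pred_of_card_succ hrev hs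
  set w : ℕ → Quiver.Total V → ℝ := fun n => (predAvg R k)^[n] g with hw
  have hstep : ∀ {e f}, R e f → Tendsto (fun n => w n e - w (n + 1) f) atTop (𝓝 0) :=
    fun hef => tendsto_iterate_predAvg_sub hk hs hp hg hsum hef
  -- The edges whose value follows that of `e₀` with time lag `j`.
  let S : ℕ → Set (Quiver.Total V) :=
    fun j => {e | Tendsto (fun n => w n e₀ - w (n + j) e) atTop (𝓝 0)}
  have hsucc : ∀ {e f}, R e f → e ∈ S 0 → f ∈ S 1 := fun {e f} hef he => by
    simpa [S] using Tendsto.add he (hstep hef)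
  have hpred : ∀ {e f}, R e f → f ∈ S 1 → e ∈ S 0 := fun {e f} hef hf => by
    simpa [S] using Tendsto.sub hf (hstep hef)
  have htarget : ∀ {e e' : Quiver.Total V} {j}, e.right = e'.right → e ∈ S j → e' ∈ S j := by
    intro e e' j h he
    obtain ⟨f, hef, hef'⟩ := hcommon e e' h
    have h1 := (hstep hef).comp (tendsto_add_atTop_nat j)
    have h2 := (hstep hef').comp (tendsto_add_atTop_nat j)
    simpa [S, Function.comp_def] using (Tendsto.add he h1).sub h2
  have hexists : ∀ f, ∃ e, R e f := fun f => by
    have : Nonempty {e // R e f} := (Nat.card_pos_iff.1 (by rw [hp]; exact hk)).1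
    exact ⟨this.some.1, this.some.2⟩
  have hcover : ∀ y, Quiver.Path e₀.right y →
      ∀ e : Quiver.Total V, e.right = y → e ∈ S 0 ∪ S 1 := by
    intro y p
    induction p with
    | nil =>
      intro e he
      refine Or.inl (htarget he.symm ?_)
      simp [S]
    | @cons b c p h ih =>
      intro e he
      obtain ⟨e₁, he₁⟩ := hexists ⟨b, c, h⟩
      obtain ⟨e₂, he₂⟩ := hexists (totalReverse ⟨b, c, h⟩)
      rcases ih e₁ (hadj _ _ he₁) with h₁ | h₁
      · exact Or.inr (htarget he.symm (hsucc he₁ h₁))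
      -- Going forward again would raise the lag to 2. Instead the reversed edge, which also ends at
      -- `b`, is followed back to a predecessor ending at `c`, so the lag returns to 0. Two lags
      -- thus suffice, and one of the two sets must be infinite.
      · have h₂ : totalReverse ⟨b, c, h⟩ ∈ S 1 := htarget (hadj _ _ he₁) h₁
        exact Or.inl (htarget ((hadj _ _ he₂).trans he.symm) (hpred he₂ h₂))
  have huniv : S 0 ∪ S 1 = Set.univ := Set.eq_univ_of_forall fun e =>
    hcover e.right (hconn _ _).some e rfl
  have hE : Infinite (Quiver.Total V) := by
    refine Infinite.of_surjective (fun e : Quiver.Total V => e.left) fun y => ?_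
    obtain ⟨p⟩ := hconn e₀.right y
    cases p with
    | nil =>
      obtain ⟨f, hf, -⟩ := hcommon e₀ e₀ rfl
      exact ⟨f, (hadj _ _ hf).symm⟩
    | cons p h => exact ⟨totalReverse ⟨_, _, h⟩, rfl⟩
  have hinf : (S 0 ∪ S 1).Infinite := huniv ▸ Set.infinite_univ
  rcases Set.infinite_union.1 hinf with h | h <;>
  exact tendsto_zero_of_infinite_sub_tendsto_zero (iterate_predAvg_nonneg hg)
    (iterate_predAvg_hasSum hk hs hg hsum) (fun n => iterate_predAvg_nonneg hg n e₀) h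

end Reverse

/-! ### Bounding path counts by iterated averages. -/

section Counting

variable {R : Quiver.Total V → Quiver.Total V → Prop} {k : ℕ} {x₀ : V}

/-- The indicator function of the edges with origin `x₀`. -/
noncomputable def originIndicator (x₀ : V) : Quiver.Total V → ℝ :=
  {e | e.left = x₀}.indicator 1

theorem originIndicator_nonneg (x₀ : V) (e : Quiver.Total V) : 0 ≤ originIndicator x₀ e :=
  Set.indicator_nonneg (fun _ _ => zero_le_one) e

theorem summable_originIndicator [Finite (Quiver.Star x₀)] : Summable (originIndicator x₀) := by
  have : Finite {e : Quiver.Total V // e.left = x₀} :=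
    Finite.of_equiv _ (starEquivOriginFiber x₀)
  refine summable_of_hasFiniteSupport (Set.Finite.subset (s := {e | e.left = x₀}) ?_ ?_)
  · exact this
  · exact Set.support_indicator_subset

/-- The paths from `x₀` of length `n + 1` satisfying `P` with last edge `e`, the last edge being
left out. -/
def pathsWithLast (P : ∀ y, Quiver.Path x₀ y → Prop) (n : ℕ) (e : Quiver.Total V) :
    Set (Quiver.Path x₀ e.left) :=
  {p | P _ (p.cons e.hom) ∧ p.length = n}

/-- A path with `n + 1` edges has `n` transitions, hence the exponent `n`. Splitting by the
penultimate edge gives the recursion of `predAvg` without its division by `k`. -/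
theorem ncard_pathsWithLast_le {P : ∀ y, Quiver.Path x₀ y → Prop} (hk : 0 < k)
    (hadj : ∀ e f, R e f → e.right = f.left) (hp : ∀ f, Nat.card {e // R e f} = k)
    (hP : ∀ {a b c : V} (p : Quiver.Path x₀ a) (h : a ⟶ b) (i : b ⟶ c),
      P _ ((p.cons h).cons i) ↔ P _ (p.cons h) ∧ R ⟨a, b, h⟩ ⟨b, c, i⟩) (n : ℕ)
    (e : Quiver.Total V) :
    ((pathsWithLast P n e).ncard : ℝ) ≤ k ^ n * (predAvg R k)^[n] (originIndicator x₀) e := by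
  induction n generalizing e with
  | zero =>
    by_cases he : e.left = x₀
    · have h1 : (pathsWithLast P 0 e).ncard ≤ 1 := by
        obtain ⟨a, b, h⟩ := e
        obtain rfl : a = x₀ := he
        have hsub : pathsWithLast P 0 ⟨a, b, h⟩ ⊆ {Quiver.Path.nil} := fun p hp =>
          Quiver.Path.eq_nil_of_length_zero p hp.2
        exact (Set.ncard_le_ncard hsub).trans_eq (Set.ncard_singleton _)
      have h2 : originIndicator x₀ e = 1 := by simp [originIndicator, he]
      simpa [h2] using h1
    · have h1 : pathsWithLast P 0 e = ∅ := by
        refine Set.eq_empty_of_forall_notMem fun p hp => ?_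
        exact he (Quiver.Path.eq_of_length_zero p hp.2).symm
      simp [h1, originIndicator_nonneg]
  | succ n ih =>
    have : Finite {e' // R e' e} := Nat.finite_of_card_ne_zero (by rw [hp]; exact hk.ne')
    have := Fintype.ofFinite {e' // R e' e}
    let F : ∀ e' : {e' // R e' e}, Quiver.Path x₀ e'.1.left → Quiver.Path x₀ e.left :=
      fun e' q => (q.cons e'.1.hom).cast rfl (hadj _ _ e'.2)
    have hF : ∀ e', Function.Injective (F e') := by
      obtain ⟨b, c, i⟩ := e
      rintro ⟨⟨a, b', h⟩, hR⟩ q q' hq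
      obtain rfl : b' = b := hadj _ _ hR
      simpa [F] using hq
    have hset : pathsWithLast P (n + 1) e = ⋃ e', F e' '' pathsWithLast P n e'.1 := by
      obtain ⟨b, c, i⟩ := e
      ext p
      simp only [Set.mem_iUnion, Set.mem_image]
      constructor
      · rintro ⟨hPp, hl⟩
        cases p with
        | nil => simp at hl
        | @cons a _ q h =>
          have := (hP q h i).1 hPp
          exact ⟨⟨⟨a, b, h⟩, this.2⟩, q, ⟨this.1, by simpa using hl⟩, rfl⟩
      · rintro ⟨⟨⟨a, b', h⟩, hR⟩, q, ⟨hPq, hl⟩, rfl⟩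
        obtain rfl : b' = b := hadj _ _ hR
        exact ⟨(hP q h i).2 ⟨hPq, hR⟩, by simpa [F] using hl⟩
    have hle : (pathsWithLast P (n + 1) e).ncard ≤
        ∑ e' : {e' // R e' e}, (pathsWithLast P n e'.1).ncard := by
      rw [hset]
      refine (Set.ncard_iUnion_le_of_fintype _).trans_eq (Finset.sum_congr rfl fun e' _ => ?_)
      exact Set.ncard_image_of_injective _ (hF e')
    have hk' : (k : ℝ) ≠ 0 := Nat.cast_ne_zero.2 hk.ne'
    calc ((pathsWithLast P (n + 1) e).ncard : ℝ)
        ≤ ∑ e' : {e' // R e' e}, ((pathsWithLast P n e'.1).ncard : ℝ) := by exact_mod_cast hle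
      _ ≤ ∑ e' : {e' // R e' e}, k ^ n * (predAvg R k)^[n] (originIndicator x₀) e' :=
        Finset.sum_le_sum fun e' _ => ih e'
      _ = _ := by
        rw [Function.iterate_succ_apply', predAvg, tsum_fintype, ← Finset.mul_sum, pow_succ]
        field_simp

theorem ncard_succ_le {P : ∀ y, Quiver.Path x₀ y → Prop} {y : V} [Fintype (Quiver.Costar y)]
    (n : ℕ) : {p : Quiver.Path x₀ y | P _ p ∧ p.length = n + 1}.ncard ≤
      ∑ e : Quiver.Costar y, (pathsWithLast P n ⟨e.1, y, e.2⟩).ncard := by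
  have hset : {p : Quiver.Path x₀ y | P _ p ∧ p.length = n + 1} =
      ⋃ e : Quiver.Costar y, (fun q => q.cons e.2) '' pathsWithLast P n ⟨e.1, y, e.2⟩ := by
    ext p
    simp only [Set.mem_iUnion, Set.mem_image]
    constructor
    · rintro ⟨hPp, hl⟩
      cases p with
      | nil => simp at hl
      | @cons a _ q h => exact ⟨⟨a, h⟩, q, ⟨hPp, by simpa using hl⟩, rfl⟩
    · rintro ⟨⟨a, h⟩, q, ⟨hPq, hl⟩, rfl⟩
      exact ⟨hPq, by simpa using hl⟩
  rw [hset]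
  refine (Set.ncard_iUnion_le_of_fintype _).trans_eq (Finset.sum_congr rfl fun e _ => ?_)
  exact Set.ncard_image_of_injective _ fun q q' h => by simpa using h

theorem ncard_length_le_succ {y : V} (P : Quiver.Path x₀ y → Prop) (n : ℕ) :
    {p | P p ∧ p.length ≤ n + 1}.ncard ≤
      {p | P p ∧ p.length ≤ n}.ncard + {p | P p ∧ p.length = n + 1}.ncard := by
  have hset : {p | P p ∧ p.length ≤ n + 1} =
      {p | P p ∧ p.length ≤ n} ∪ {p | P p ∧ p.length = n + 1} := by
    ext p
    simp only [Set.mem_ofPred_eq, Set.mem_union, ← and_or_left, Nat.le_succ_iff]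
  rw [hset]
  exact Set.ncard_union_le _ _

end Counting

/-! ### Limits of the normalised counts of closed paths. -/

section Asymptotics

variable [Quiver.HasInvolutiveReverse V] {R : Quiver.Total V → Quiver.Total V → Prop} {k : ℕ}
  {x₀ : V}

theorem tendsto_ncard_div_pow [Infinite V] (hconn : Connected V) (hfin : Finite (Quiver.Star x₀))
    (hk : 2 ≤ k)
    (hadj : ∀ e f, R e f → e.right = f.left)
    (hrev : ∀ e f, R e f ↔ R (totalReverse f) (totalReverse e))
    (hs : ∀ e, Nat.card {f // R e f} = k)
    (hcommon : ∀ e e' : Quiver.Total V, e.right = e'.right → ∃ f, R e f ∧ R e' f)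
    (P : ∀ y, Quiver.Path x₀ y → Prop)
    (hP : ∀ {a b c : V} (p : Quiver.Path x₀ a) (h : a ⟶ b) (i : b ⟶ c),
      P _ ((p.cons h).cons i) ↔ P _ (p.cons h) ∧ R ⟨a, b, h⟩ ⟨b, c, i⟩) :
    Tendsto (fun n => ({p | P x₀ p ∧ p.length = n}.ncard : ℝ) / (k : ℝ) ^ n) atTop (𝓝 0) ∧
    Tendsto (fun n => ({p | P x₀ p ∧ p.length ≤ n}.ncard : ℝ) / (k : ℝ) ^ n) atTop (𝓝 0) := by
  have hk0 : 0 < k := by omega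
  have hkR : (2 : ℝ) ≤ k := by exact_mod_cast hk
  have hp := card_pred_of_card_succ hrev hs
  have : Finite (Quiver.Costar x₀) := Finite.of_equiv _ (Quiver.starEquivCostar x₀)
  have := Fintype.ofFinite (Quiver.Costar x₀)
  have hclosed : Tendsto (fun n => ({p | P x₀ p ∧ p.length = n}.ncard : ℝ) / (k : ℝ) ^ n)
      atTop (𝓝 0) := by
    rw [← tendsto_add_atTop_iff_nat 1]
    have hlim : Tendsto (fun n => ∑ e : Quiver.Costar x₀,
        (predAvg R k)^[n] (originIndicator x₀) ⟨e.1, x₀, e.2⟩) atTop (𝓝 0) := by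
      simpa using tendsto_finsetSum Finset.univ fun (e : Quiver.Costar x₀) _ =>
        tendsto_iterate_predAvg hconn hk0 hadj hrev hs hcommon (originIndicator_nonneg x₀)
          summable_originIndicator ⟨e.1, x₀, e.2⟩
    refine squeeze_zero (fun n => by positivity) (fun n => ?_) hlim
    have hpow : (0 : ℝ) < (k : ℝ) ^ n := by positivity
    -- The spare factor `k` is discarded; the rest is a sum over the finitely many last edges ending
    -- at `x₀`.
    calc ({p | P x₀ p ∧ p.length = n + 1}.ncard : ℝ) / (k : ℝ) ^ (n + 1)
        ≤ ({p | P x₀ p ∧ p.length = n + 1}.ncard : ℝ) / (k : ℝ) ^ n := by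
          gcongr
          · linarith
          · omega
      _ ≤ (∑ e : Quiver.Costar x₀, ((pathsWithLast P n ⟨e.1, x₀, e.2⟩).ncard : ℝ)) / k ^ n := by
          gcongr
          exact_mod_cast ncard_succ_le n
      _ ≤ _ := by
          rw [div_le_iff₀' hpow, Finset.mul_sum]
          exact Finset.sum_le_sum fun e _ => ncard_pathsWithLast_le hk0 hadj hp hP n _
  refine ⟨hclosed, tendsto_zero_of_le_half_add (fun n => by positivity) (fun n => ?_) hclosed⟩
  have hle : ({p | P x₀ p ∧ p.length ≤ n + 1}.ncard : ℝ) ≤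
      {p | P x₀ p ∧ p.length ≤ n}.ncard + {p | P x₀ p ∧ p.length = n + 1}.ncard := by
    exact_mod_cast ncard_length_le_succ (P x₀) n
  calc ({p | P x₀ p ∧ p.length ≤ n + 1}.ncard : ℝ) / (k : ℝ) ^ (n + 1)
      ≤ ({p | P x₀ p ∧ p.length ≤ n}.ncard + {p | P x₀ p ∧ p.length = n + 1}.ncard) /
        (k : ℝ) ^ (n + 1) := by gcongr
    _ = ({p | P x₀ p ∧ p.length ≤ n}.ncard : ℝ) / (k : ℝ) ^ n / k +
        {p | P x₀ p ∧ p.length = n + 1}.ncard / (k : ℝ) ^ (n + 1) := by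
        rw [add_div, pow_succ, div_div]
    _ ≤ _ := by gcongr

theorem star_mk_ne_reverse_iff {a b c : V} (h : a ⟶ b) (i : b ⟶ c) :
    Quiver.Star.mk i ≠ Quiver.Star.mk (Quiver.reverse h) ↔
      (⟨b, c, i⟩ : Quiver.Total V) ≠ totalReverse ⟨a, b, h⟩ := by
  refine not_congr ⟨fun H => ?_, fun H => ?_⟩
  · exact congrArg (fun s : Quiver.Star b => (⟨b, s.1, s.2⟩ : Quiver.Total V)) H
  · exact (starEquivOriginFiber b).injective
      (Subtype.ext (H : (⟨b, c, i⟩ : Quiver.Total V) = ⟨b, a, Quiver.reverse h⟩))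

end Asymptotics

end GraphPaths

open GraphPaths in
theorem theorem5p7 {V : Type*} [Quiver V] [Quiver.HasInvolutiveReverse V] [Infinite V]
    (hconn : GraphPaths.Connected V) (d : ℕ) (hd : 3 ≤ d)
    (hreg : GraphPaths.RegularOfDegree V d) (x₀ : V) :
    (Filter.Tendsto (fun n : ℕ => (GraphPaths.numReducedClosed x₀ n : ℝ) / ((d : ℝ) - 1) ^ n)
        Filter.atTop (nhds 0) ∧
      Filter.Tendsto (fun n : ℕ => (GraphPaths.numClosed x₀ n : ℝ) / (d : ℝ) ^ n)
        Filter.atTop (nhds 0)) ∧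
    (Filter.Tendsto (fun n : ℕ => (GraphPaths.numReducedClosedLE x₀ n : ℝ) / ((d : ℝ) - 1) ^ n)
        Filter.atTop (nhds 0) ∧
      Filter.Tendsto (fun n : ℕ => (GraphPaths.numClosedLE x₀ n : ℝ) / (d : ℝ) ^ n)
        Filter.atTop (nhds 0)) := by
  have hfin : Finite (Quiver.Star x₀) := Nat.finite_of_card_ne_zero (by rw [hreg]; omega)
  have hall := tendsto_ncard_div_pow (R := fun e f => e.right = f.left) (k := d) (x₀ := x₀)
    hconn hfin (by omega) (fun _ _ h => h) (fun e f => eq_comm)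
    (fun e => by
      simpa only [eq_comm, Set.coe_ofPred] using
        (Nat.card_coe_set_eq _).trans (ncard_origin_eq hreg e.right))
    (fun e e' h => by
      have : {f : Quiver.Total V | f.left = e.right}.Nonempty :=
        Set.nonempty_of_ncard_ne_zero (by rw [ncard_origin_eq hreg]; omega)
      obtain ⟨f, hf⟩ := this
      exact ⟨f, hf.symm, h.symm.trans hf.symm⟩)
    (fun _ _ => True) (by simp)
  have hred := tendsto_ncard_div_pow
    (R := fun e f : Quiver.Total V => e.right = f.left ∧ f ≠ totalReverse e) (k := d - 1)
    (x₀ := x₀) hconn hfin (by omega) (fun _ _ h => h.1)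
    (fun e f => by
      have : totalReverse e = totalReverse (totalReverse f) ↔ f = totalReverse e := by
        rw [totalReverse_totalReverse, eq_comm]
      simp only [totalReverse_right, totalReverse_left, ne_eq, this]
      rw [eq_comm])
    (fun e => by
      -- The forbidden edge is one of the `d` edges leaving the terminus of `e`, so exactly `d - 1`
      -- remain.
      have hmem : totalReverse e ∈ {f : Quiver.Total V | f.left = e.right} := rfl
      rw [← ncard_origin_eq hreg e.right, ← Set.ncard_sdiff_singleton_of_mem hmem,
        ← Nat.card_coe_set_eq]
      simp only [eq_comm (a := e.right)]
      rfl)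
    (fun e e' h => by
      -- As `d ≥ 3`, some edge at the common terminus avoids both inverses.
      have hlt : ({totalReverse e, totalReverse e'} : Set (Quiver.Total V)).ncard <
          {f : Quiver.Total V | f.left = e.right}.ncard := by
        rw [ncard_origin_eq hreg]
        exact (Set.ncard_insert_le _ _).trans_lt (by rw [Set.ncard_singleton]; omega)
      obtain ⟨f, hf, hne⟩ := Set.exists_mem_notMem_of_ncard_lt_ncard hlt
      simp only [Set.mem_insert_iff, Set.mem_singleton_iff, not_or] at hne
      exact ⟨f, ⟨hf.symm, hne.1⟩, h.symm.trans hf.symm, hne.2⟩)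
    (fun _ p => IsReducedPath p)
    (fun p h i => by
      rw [IsReducedPath, star_mk_ne_reverse_iff]
      simp)
  rw [Nat.cast_sub (by omega), Nat.cast_one] at hred
  simp only [true_and] at hall
  exact ⟨⟨hred.1, hall.1⟩, hred.2, hall.2⟩
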